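/- Let $E$ be a regular biordered set in the sense of Nambooripad: a non-empty set with a partial binary operation whose relations $\omega^l=\{(e,f): ef=e\}$ and $\omega^r=\{(e,f): fe=e\}$ are quasi-orders, which satisfies Nambooripad's biordered set axioms, and in which every sandwich set $S(e,f)$ is non-empty. Write $\omega=\omega^l\cap\omega^r$, $\mathcal L=\omega^l\cap(\omega^l)^{-1}$, $\mathcal R=\omega^r\cap(\omega^r)^{-1}$ and $M(e,f)=\{g\in E: g\,\omega^l\,e,\ g\,\omega^r\,f\}$. Suppose that: (E1) there is an element $0\in E$ such that $0\,\omega\,e$ for every $e\in E$; (E2) there is a map $e\mapsto e'$ from $E$ to $E$ such that for all $e,f\in E$: (i) $e''=e$; (ii) $f\,\omega^l\,e$ if and only if $e'\,\omega^r\,f'$; (iii) $f\,\omega^l\,e'$ if and only if $M(f,e)=\{0\}$. For $e,f\in E$ let $d_l(e,f)$ be the least $n\ge1$ for which there is a sequence $e=e_0,e_1,\dots,e_n=f$ in $E$ with $e_0\,\mathcal L\,e_1$ and $e_{i-1}\,(\mathcal L\cup\mathcal R)\,e_i$ for $1\le i\le n$, and let $d_l(e,f)=0$ if there is no such sequence.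 Let $\mathcal L(e)$ denote the $\mathcal L$-class of $e$, and order $E/\mathcal L$ by $\mathcal L(a)\le\mathcal L(b)$ if and only if $a\,\omega^l\,b$. Then, for all $e,f\in E$ with $1\le d_l(e,f)\le3$, the ordered set $E/\mathcal L$ is a bounded lattice in which $\mathcal L(e)$ and $\mathcal L(f)$ are in perspective, that is, have a common complement. More precisely, there are $g,h\in E$ with $e\,\mathcal L\,g\,\mathcal R\,h\,\mathcal L\,f$, and for all such $g,h$ the class $\mathcal L(g')$ is a complement of both $\mathcal L(e)$ and $\mathcal L(f)$. -/

import Mathlib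

namespace Biorder

/-- A set with a partial binary operation: `Dom e f` says that the product of `e` and `f` is
defined, and then `e * f` is its value. The values of `*` outside `Dom` carry no information:
nothing below depends on them. -/
class PartialMul (E : Type*) extends Mul E where
  Dom : E → E → Prop

section Relations

variable {E : Type*} [PartialMul E]

/-- `e ωˡ f`: the product `ef` is defined and equals `e`. -/
def OmL (e f : E) : Prop := PartialMul.Dom e f ∧ e * f = e

/-- `e ωʳ f`: the product `fe` is defined and equals `e`. -/
def OmR (e f : E) : Prop := PartialMul.Dom f e ∧ f * e = e

/-- `ω = ωˡ ∩ ωʳ`. -/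
def Om (e f : E) : Prop := OmL e f ∧ OmR e f

/-- `ℒ = ωˡ ∩ (ωˡ)⁻¹`. -/
def RelL (e f : E) : Prop := OmL e f ∧ OmL f e

/-- `ℛ = ωʳ ∩ (ωʳ)⁻¹`. -/
def RelR (e f : E) : Prop := OmR e f ∧ OmR f e

/-- `M(e, f) = ωˡ(e) ∩ ωʳ(f)`. -/
def MSet (e f : E) : Set E := {g | OmL g e ∧ OmR g f}

/-- The quasi-order `≼` on `M(e, f)`: `g ≼ h` if and only if `eg ωʳ eh` and `gf ωˡ hf`. -/
def SandwichLe (e f g h : E) : Prop := OmR (e * g) (e * h) ∧ OmL (g * f) (h * f)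

/-- The sandwich set `S(e, f)`: the elements of `M(e, f)` that are above all of `M(e, f)`. -/
def Sandwich (e f : E) : Set E := {h | h ∈ MSet e f ∧ ∀ g ∈ MSet e f, SandwichLe e f g h}

end Relations

/-- Biordered sets in the sense of Nambooripad: every axiom is followed by its left-right dual.
All products that occur in the axioms are defined as a consequence of the axioms before them. -/
class BiorderedSet (E : Type*) extends PartialMul E where
  nonempty : Nonempty E
  omL_refl : ∀ e : E, OmL e e
  omL_trans : ∀ e f g : E, OmL e f → OmL f g → OmL e g
  omR_refl : ∀ e : E, OmR e e
  omR_trans : ∀ e f g : E, OmR e f → OmR f g → OmR e g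
  dom_iff : ∀ e f : E, Dom e f ↔ (OmL e f ∨ OmR e f) ∨ (OmL f e ∨ OmR f e)
  /-- `f ∈ ωʳ(e)` implies `f ℛ fe ω e`. -/
  b21 : ∀ e f : E, OmR f e → RelR f (f * e) ∧ Om (f * e) e
  b21_dual : ∀ e f : E, OmL f e → RelL f (e * f) ∧ Om (e * f) e
  /-- `g ωˡ f` and `f, g ∈ ωʳ(e)` imply `ge ωˡ fe`. -/
  b22 : ∀ e f g : E, OmL g f → OmR f e → OmR g e → OmL (g * e) (f * e)
  b22_dual : ∀ e f g : E, OmR g f → OmL f e → OmL g e → OmR (e * g) (e * f)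
  /-- `g ωʳ f ωʳ e` implies `gf = (ge)f`. -/
  b31 : ∀ e f g : E, OmR g f → OmR f e → g * f = (g * e) * f
  b31_dual : ∀ e f g : E, OmL g f → OmL f e → f * g = f * (e * g)
  /-- `g ωˡ f` and `f, g ∈ ωʳ(e)` imply `(fg)e = (fe)(ge)`. -/
  b32 : ∀ e f g : E, OmL g f → OmR f e → OmR g e → (f * g) * e = (f * e) * (g * e)
  b32_dual : ∀ e f g : E, OmR g f → OmL f e → OmL g e → e * (g * f) = (e * g) * (e * f)
  /-- `f, g ∈ ωʳ(e)` implies `S(f, g)e = S(fe, ge)`. -/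
  b4 : ∀ e f g : E, OmR f e → OmR g e →
    (fun h => h * e) '' Sandwich f g = Sandwich (f * e) (g * e)
  b4_dual : ∀ e f g : E, OmL f e → OmL g e →
    (fun h => e * h) '' Sandwich f g = Sandwich (e * f) (e * g)

section Theory

variable {E : Type*} [BiorderedSet E]

/-- A biordered set is regular if all its sandwich sets are non-empty. -/
def IsRegular (E : Type*) [BiorderedSet E] : Prop := ∀ e f : E, (Sandwich e f).Nonempty

/-- Condition (E1) for the element `z`: `z ω e` for every `e`. -/
def CondE1 (z : E) : Prop := ∀ e : E, Om z e

/-- Condition (E2) for the map `c : e ↦ e'` and the zero `z`. -/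
structure CondE2 (z : E) (c : E → E) : Prop where
  invol : ∀ e : E, c (c e) = e
  omL_iff : ∀ e f : E, OmL f e ↔ OmR (c e) (c f)
  omL_compl_iff : ∀ e f : E, OmL f (c e) ↔ MSet f e = {z}

/-- There is an `E`-sequence `e = s 0, s 1, …, s n = f` of length `n ≥ 1` whose successive
elements are related by `ℒ` or `ℛ` and whose first step is `ℒ`. -/
def HasLSeq (e f : E) (n : ℕ) : Prop :=
  1 ≤ n ∧ ∃ s : ℕ → E, s 0 = e ∧ s n = f ∧ RelL (s 0) (s 1) ∧
    ∀ i < n, RelL (s i) (s (i + 1)) ∨ RelR (s i) (s (i + 1))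

/-- `d_l(e, f)`: the length of a shortest `E`-sequence from `e` to `f` that starts with `ℒ`,
and `0` if there is none (the infimum of the empty set of natural numbers is `0`). -/
noncomputable def dl (e f : E) : ℕ := sInf {n | HasLSeq e f n}

variable (E) in
/-- The equivalence relation `ℒ`. -/
def lSetoid : Setoid E where
  r := RelL
  iseqv :=
    { refl := fun e => ⟨BiorderedSet.omL_refl e, BiorderedSet.omL_refl e⟩
      symm := fun h => ⟨h.2, h.1⟩
      trans := fun h k => ⟨BiorderedSet.omL_trans _ _ _ h.1 k.1,
        BiorderedSet.omL_trans _ _ _ k.2 h.2⟩ }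

variable (E) in
/-- The quotient `E/ℒ`. -/
def LQuot : Type _ := Quotient (lSetoid E)

/-- The class `ℒ(e)` as an element of `E/ℒ`. -/
def lClass (e : E) : LQuot E := Quotient.mk (lSetoid E) e

/-- The order of the given lattice structure on `E/ℒ` is the partial order of `E/ℒ`:
`ℒ(a) ≤ ℒ(b)` if and only if `a ωˡ b`. At most one lattice structure has this property. -/
def IsLOrder (lat : Lattice (LQuot E)) : Prop :=
  ∀ a b : E, lat.le (lClass a) (lClass b) ↔ OmL a b

end Theory

/-- Two elements of a bounded lattice are in perspective if they have a common complement. -/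
def InPerspective {P : Type*} [Lattice P] [BoundedOrder P] (a b : P) : Prop :=
  ∃ x : P, IsCompl a x ∧ IsCompl b x

end Biorder

/-! Complementation exchanges `ωˡ` and `ωʳ`, so `g ℛ h` gives `g' ℒ h'`. Since `ℒ(e')` is always a
complement of `ℒ(e)`, the class `ℒ(g') = ℒ(h')` serves both ends of `e ℒ g ℛ h ℒ f`.

The substance is that meets exist. Below `e`, the element `f` may be replaced by `k = (eh)'` with `h
∈ S(e, f')` (`omL_iff_omL_compl_mul`). Then `e' ω k`, and for `s ∈ S(e, k)` the class of `sk` is the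
meet (`exists_meet_of_compl_om`). Joins follow by left-right duality and complementation. -/

namespace Biorder

section Dual

variable {E : Type*}

/-- The partial operation with the factors exchanged. -/
@[reducible] def dualPartialMul (P : PartialMul E) : PartialMul E where
  mul a b := b * a
  Dom a b := P.Dom b a

theorem mSet_dual (P : PartialMul E) (a b : E) :
    @MSet E (dualPartialMul P) a b = MSet b a :=
  Set.ext fun _ => and_comm

theorem sandwich_dual (P : PartialMul E) (a b : E) :
    @Sandwich E (dualPartialMul P) a b = Sandwich b a := by
  ext h
  exact ⟨fun k => ⟨⟨k.1.2, k.1.1⟩, fun g hg => ⟨(k.2 g ⟨hg.2, hg.1⟩).2, (k.2 g ⟨hg.2, hg.1⟩).1⟩⟩,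
    fun k => ⟨⟨k.1.2, k.1.1⟩, fun g hg => ⟨(k.2 g ⟨hg.2, hg.1⟩).2, (k.2 g ⟨hg.2, hg.1⟩).1⟩⟩⟩

/-- The left-right dual of a biordered set, on the same type. -/
@[reducible] def dualBiorder (B : BiorderedSet E) : BiorderedSet E where
  toPartialMul := dualPartialMul B.toPartialMul
  nonempty := B.nonempty
  omL_refl := B.omR_refl
  omL_trans := B.omR_trans
  omR_refl := B.omL_refl
  omR_trans := B.omL_trans
  dom_iff e f := (B.dom_iff f e).trans (or_comm.trans (or_congr or_comm or_comm))
  b21 e f h := ⟨(B.b21_dual e f h).1, (B.b21_dual e f h).2.symm⟩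
  b21_dual e f h := ⟨(B.b21 e f h).1, (B.b21 e f h).2.symm⟩
  b22 := B.b22_dual
  b22_dual := B.b22
  b31 := B.b31_dual
  b31_dual := B.b31
  b32 := B.b32_dual
  b32_dual := B.b32
  b4 e f g hf hg := by
    rw [sandwich_dual, sandwich_dual]
    exact B.b4_dual e g f hg hf
  b4_dual e f g hf hg := by
    rw [sandwich_dual, sandwich_dual]
    exact B.b4 e g f hg hf

end Dual

/-! ### Zero and trivial sandwich sets. -/

section Zero

variable {E : Type*} [B : BiorderedSet E] {z : E}

theorem IsRegular.dual (hreg : IsRegular E) : @IsRegular E (dualBiorder B) := fun e f => by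
  rw [sandwich_dual]
  exact hreg f e

theorem CondE1.dual (h : CondE1 z) : @CondE1 E (dualBiorder B) z := fun e => (h e).symm

theorem eq_zero_of_omL (h : CondE1 z) {g : E} (hg : OmL g z) : g = z :=
  hg.2.symm.trans (h g).2.2

theorem eq_zero_of_omR (h : CondE1 z) {g : E} (hg : OmR g z) : g = z :=
  hg.2.symm.trans (h g).1.2

theorem mul_zero_eq (h : CondE1 z) (e : E) : e * z = z := (h e).2.2

theorem zero_mul_eq (h : CondE1 z) (e : E) : z * e = z := (h e).1.2

theorem zero_mem_mSet (h : CondE1 z) (a b : E) : z ∈ MSet a b := ⟨(h a).1, (h b).2⟩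

theorem mSet_eq_zero_iff (h : CondE1 z) {a b : E} :
    MSet a b = {z} ↔ ∀ g, OmL g a → OmR g b → g = z :=
  ⟨fun k g ha hb => by
    have : g ∈ MSet a b := ⟨ha, hb⟩
    rwa [k] at this,
   fun k => Set.eq_singleton_iff_unique_mem.2 ⟨zero_mem_mSet h a b, fun g hg => k g hg.1 hg.2⟩⟩

/-- Here `g ℒ eg`, and only `0` lies below `0`. -/
theorem eq_zero_of_mul_eq_zero (h : CondE1 z) {e g : E} (hg : OmL g e) (k : e * g = z) : g = z :=
  eq_zero_of_omL h (k ▸ (BiorderedSet.b21_dual e g hg).1.1)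

theorem mSet_eq_zero_of_zero_mem_sandwich (h : CondE1 z) {a b : E} (hz : z ∈ Sandwich a b) :
    MSet a b = {z} := by
  refine (mSet_eq_zero_iff h).2 fun g ha hb => eq_zero_of_mul_eq_zero h ha ?_
  have := (hz.2 g ⟨ha, hb⟩).1
  rw [mul_zero_eq h] at this
  exact eq_zero_of_omR h this

theorem zero_mem_sandwich (hreg : IsRegular E) {a b : E} (hz : MSet a b = {z}) :
    z ∈ Sandwich a b := by
  obtain ⟨s, hs⟩ := hreg a b
  have : s ∈ MSet a b := hs.1
  rw [hz] at this
  rwa [Set.mem_singleton_iff.1 this] at hs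

end Zero

/-! ### Meets, joins and complements. -/

section Complement

variable {E : Type*} [B : BiorderedSet E] {z : E} {c : E → E}

theorem CondE2.omR_iff (h2 : CondE2 z c) (e f : E) : OmR f e ↔ OmL (c e) (c f) := by
  rw [h2.omL_iff (c f) (c e), h2.invol, h2.invol]

theorem CondE2.dual (h2 : CondE2 z c) : @CondE2 E (dualBiorder B) z c :=
  @CondE2.mk E (dualBiorder B) z c h2.invol h2.omR_iff fun e f => by
    rw [mSet_dual, ← h2.omL_compl_iff f e]
    exact (h2.omR_iff (c e) f).trans (by rw [h2.invol])

/-- If `x ωˡ e` and `h ∈ S(e, f')`, then `x` lies below `f` exactly if it lies below `(eh)'`. -/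
theorem omL_iff_omL_compl_mul (hreg : IsRegular E) (h1 : CondE1 z) (h2 : CondE2 z c)
    {e f h x : E} (hh : h ∈ Sandwich e (c f)) (hx : OmL x e) :
    OmL x f ↔ OmL x (c (e * h)) := by
  have hhe : OmL h e := hh.1.1
  have heh : RelL h (e * h) ∧ Om (e * h) e := BiorderedSet.b21_dual e h hhe
  have hxf : OmL x f ↔ MSet x (c f) = {z} := by rw [← h2.omL_compl_iff, h2.invol]
  have hee : e * (e * h) = e * h := heh.2.2.2
  rw [hxf, h2.omL_compl_iff]
  constructor
  · intro k
    have hxh : MSet x h = {z} := (mSet_eq_zero_iff h1).2 fun g ga gb =>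
      (mSet_eq_zero_iff h1).1 k g ga (BiorderedSet.omR_trans _ _ _ gb hh.1.2)
    have hz := zero_mem_sandwich hreg hxh
    -- As `e(eh) = eh`, the sets `S(x, eh)` and `S(x, h)` have the same image under left
    -- multiplication by `e`, by `b4_dual`.
    have key : z ∈ (fun t => e * t) '' Sandwich x (e * h) := by
      rw [BiorderedSet.b4_dual e x (e * h) hx heh.2.1, hee, ← BiorderedSet.b4_dual e x h hx hhe]
      exact ⟨z, hz, mul_zero_eq h1 e⟩
    obtain ⟨t, ht, hte⟩ := key
    have : t = z :=
      eq_zero_of_mul_eq_zero h1 (BiorderedSet.omL_trans _ _ _ ht.1.1 hx) hte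
    exact mSet_eq_zero_of_zero_mem_sandwich h1 (this ▸ ht)
  · intro k
    refine (mSet_eq_zero_iff h1).2 fun g ga gb => ?_
    have hge := BiorderedSet.omL_trans _ _ _ ga hx
    have hg := BiorderedSet.b21_dual e g hge
    -- The element `eg` lies in `M(x, eh)`: `eg ℒ g`, and `eg ωʳ eh` because `h` dominates `M(e,
    -- f')`.
    exact eq_zero_of_mul_eq_zero h1 hge ((mSet_eq_zero_iff h1).1 k _
      (BiorderedSet.omL_trans _ _ _ hg.1.2 ga) (hh.2 g ⟨hge, gb⟩).1)

/-- If `e' ω k`, then `ℒ(e)` and `ℒ(k)` have a meet. -/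
theorem exists_meet_of_compl_om (hreg : IsRegular E) (h1 : CondE1 z) (h2 : CondE2 z c)
    {e k : E} (hk : Om (c e) k) : ∃ p, ∀ x, OmL x p ↔ OmL x e ∧ OmL x k := by
  obtain ⟨h, hh⟩ := hreg e k
  have hp := BiorderedSet.b21 k h hh.1.2
  have hpe : OmL (h * k) e := by
    have hM : MSet h (c e) = {z} := by
      rw [← h2.omL_compl_iff, h2.invol]
      exact hh.1.1
    -- Since `e'k = e'`, right multiplication by `k` carries `0 ∈ S(h, e')` into `S(hk, e')`.
    have := BiorderedSet.b4 k h (c e) hh.1.2 hk.2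
    rw [hk.1.2] at this
    have hz : z ∈ Sandwich (h * k) (c e) :=
      this ▸ ⟨z, zero_mem_sandwich hreg hM, zero_mul_eq h1 k⟩
    have := (h2.omL_compl_iff (c e) (h * k)).2 (mSet_eq_zero_of_zero_mem_sandwich h1 hz)
    rwa [h2.invol] at this
  refine ⟨h * k, fun x => ⟨fun hx => ⟨BiorderedSet.omL_trans _ _ _ hx hpe,
    BiorderedSet.omL_trans _ _ _ hx hp.2.1⟩, fun ⟨hxe, hxk⟩ => ?_⟩⟩
  have hkx := BiorderedSet.b21_dual k x hxk
  -- Unlike `x`, its `ℒ`-equivalent `kx` is known to lie in `M(e, k)`; also `(kx)k = kx`.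
  have := (hh.2 (k * x) ⟨BiorderedSet.omL_trans _ _ _ hkx.1.2 hxe, hkx.2.2⟩).2
  rw [hkx.2.1.2] at this
  exact BiorderedSet.omL_trans _ _ _ hkx.1.1 this

theorem exists_omL_meet (hreg : IsRegular E) (h1 : CondE1 z) (h2 : CondE2 z c) (e f : E) :
    ∃ p, ∀ x, OmL x p ↔ OmL x e ∧ OmL x f := by
  obtain ⟨h, hh⟩ := hreg e (c f)
  have heh := (BiorderedSet.b21_dual e h hh.1.1).2
  have hk : Om (c e) (c (e * h)) := ⟨(h2.omR_iff _ _).1 heh.2, (h2.omL_iff _ _).1 heh.1⟩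
  obtain ⟨p, hp⟩ := exists_meet_of_compl_om hreg h1 h2 hk
  exact ⟨p, fun x => (hp x).trans (and_congr_right fun hx =>
    (omL_iff_omL_compl_mul hreg h1 h2 hh hx).symm)⟩

theorem exists_omR_meet (hreg : IsRegular E) (h1 : CondE1 z) (h2 : CondE2 z c) (e f : E) :
    ∃ p, ∀ x, OmR x p ↔ OmR x e ∧ OmR x f :=
  @exists_omL_meet E (dualBiorder B) z c hreg.dual h1.dual h2.dual e f

theorem exists_omL_join (hreg : IsRegular E) (h1 : CondE1 z) (h2 : CondE2 z c) (e f : E) :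
    ∃ s, ∀ x, OmL s x ↔ OmL e x ∧ OmL f x := by
  obtain ⟨p, hp⟩ := exists_omR_meet hreg h1 h2 (c e) (c f)
  refine ⟨c p, fun x => ?_⟩
  rw [h2.omL_iff x (c p), h2.invol, h2.omL_iff x e, h2.omL_iff x f]
  exact hp (c x)

/-- The product `ex` lies in `M(x, e)`, which is trivial by (E2)(iii). -/
theorem eq_zero_of_omL_compl (h1 : CondE1 z) (h2 : CondE2 z c) {e x : E}
    (hx : OmL x e) (hx' : OmL x (c e)) : x = z := by
  have hex := BiorderedSet.b21_dual e x hx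
  exact eq_zero_of_mul_eq_zero h1 hx
    ((mSet_eq_zero_iff h1).1 ((h2.omL_compl_iff e x).1 hx') _ hex.1.2 hex.2.2)

theorem eq_zero_of_omR_compl (h1 : CondE1 z) (h2 : CondE2 z c) {e x : E}
    (hx : OmR x e) (hx' : OmR x (c e)) : x = z :=
  @eq_zero_of_omL_compl E (dualBiorder B) z c h1.dual h2.dual e x hx hx'

theorem omL_compl_zero (h1 : CondE1 z) (h2 : CondE2 z c) (x : E) : OmL x (c z) := by
  rw [h2.omL_compl_iff, mSet_eq_zero_iff h1]
  exact fun g _ hg => eq_zero_of_omR h1 hg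

/-- After complementation, `x'` is `ωʳ`-below both `e` and `e'`, hence zero. -/
theorem eq_compl_zero_of_omL (h1 : CondE1 z) (h2 : CondE2 z c) {e x : E}
    (hx : OmL e x) (hx' : OmL (c e) x) : x = c z := by
  have hz : c x = z := by
    refine eq_zero_of_omR_compl h1 h2 (e := e) ?_ ((h2.omL_iff _ _).1 hx)
    have := (h2.omL_iff _ _).1 hx'
    rwa [h2.invol] at this
  rw [← hz, h2.invol]

end Complement

/-! ### The order on `E/ℒ` and short `E`-sequences. -/

section Quotient

variable {E : Type*} [B : BiorderedSet E]

theorem lClass_eq_iff {a b : E} : lClass a = lClass b ↔ RelL a b :=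
  ⟨fun h => Quotient.exact (s := lSetoid E) h, fun h => Quotient.sound (s := lSetoid E) h⟩

theorem LQuot.ind {p : LQuot E → Prop} (h : ∀ a : E, p (lClass a)) (x : LQuot E) : p x :=
  Quotient.ind (s := lSetoid E) h x

variable (E) in
/-- The partial order of `E/ℒ` induced by `ωˡ`. -/
@[reducible] def lPartialOrder : PartialOrder (LQuot E) where
  le := Quotient.lift₂ (s₁ := lSetoid E) (s₂ := lSetoid E) OmL fun _ _ _ _ h k => propext
    ⟨fun t => BiorderedSet.omL_trans _ _ _ (BiorderedSet.omL_trans _ _ _ h.2 t) k.1,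
      fun t => BiorderedSet.omL_trans _ _ _ (BiorderedSet.omL_trans _ _ _ h.1 t) k.2⟩
  le_refl := LQuot.ind BiorderedSet.omL_refl
  le_trans := LQuot.ind fun a => LQuot.ind fun b => LQuot.ind fun d =>
    BiorderedSet.omL_trans a b d
  le_antisymm := LQuot.ind fun _ => LQuot.ind fun _ => fun h k => lClass_eq_iff.2 ⟨h, k⟩

theorem exists_lattice_isLOrder
    (hinf : ∀ e f : E, ∃ p, ∀ x, OmL x p ↔ OmL x e ∧ OmL x f)
    (hsup : ∀ e f : E, ∃ s, ∀ x, OmL s x ↔ OmL e x ∧ OmL f x) :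
    ∃ lat : Lattice (LQuot E), IsLOrder lat := by
  let _ := lPartialOrder E
  have hinf' : ∀ a b : LQuot E, ∃ p, ∀ x, x ≤ p ↔ x ≤ a ∧ x ≤ b :=
    LQuot.ind fun a => LQuot.ind fun b => (hinf a b).imp' lClass fun _ hp => LQuot.ind hp
  have hsup' : ∀ a b : LQuot E, ∃ s, ∀ x, s ≤ x ↔ a ≤ x ∧ b ≤ x :=
    LQuot.ind fun a => LQuot.ind fun b => (hsup a b).imp' lClass fun _ hp => LQuot.ind hp
  choose i hi using hinf'
  choose s hs using hsup'
  exact ⟨{ lPartialOrder E with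
    inf := i
    sup := s
    inf_le_left := fun a b => ((hi a b _).1 le_rfl).1
    inf_le_right := fun a b => ((hi a b _).1 le_rfl).2
    le_inf := fun a b d h k => (hi b d a).2 ⟨h, k⟩
    le_sup_left := fun a b => ((hs a b _).1 le_rfl).1
    le_sup_right := fun a b => ((hs a b _).1 le_rfl).2
    sup_le := fun a b d h k => (hs a b d).2 ⟨h, k⟩ }, fun _ _ => Iff.rfl⟩

/-- An `E`-sequence of length at most `3` that starts with `ℒ` can be brought to the form
`e ℒ g ℛ h ℒ f`. -/
theorem HasLSeq.exists_relL_relR_relL {e f : E} {n : ℕ} (h : HasLSeq e f n) (hn : n ≤ 3) :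
    ∃ g h : E, RelL e g ∧ RelR g h ∧ RelL h f := by
  have lrefl : ∀ a : E, RelL a a := fun a => ⟨BiorderedSet.omL_refl a, BiorderedSet.omL_refl a⟩
  have rrefl : ∀ a : E, RelR a a := fun a => ⟨BiorderedSet.omR_refl a, BiorderedSet.omR_refl a⟩
  have ltrans : ∀ {a b d : E}, RelL a b → RelL b d → RelL a d := fun h k =>
    ⟨BiorderedSet.omL_trans _ _ _ h.1 k.1, BiorderedSet.omL_trans _ _ _ k.2 h.2⟩
  have rtrans : ∀ {a b d : E}, RelR a b → RelR b d → RelR a d := fun h k =>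
    ⟨BiorderedSet.omR_trans _ _ _ h.1 k.1, BiorderedSet.omR_trans _ _ _ k.2 h.2⟩
  obtain ⟨hn1, s, rfl, rfl, h0, hs⟩ := h
  interval_cases n
  · exact ⟨s 1, s 1, h0, rrefl _, lrefl _⟩
  · rcases hs 1 (by norm_num) with h1 | h1
    · exact ⟨s 1, s 1, h0, rrefl _, h1⟩
    · exact ⟨s 1, s 2, h0, h1, lrefl _⟩
  · rcases hs 1 (by norm_num) with h1 | h1 <;> rcases hs 2 (by norm_num) with h2 | h2
    · exact ⟨s 1, s 1, h0, rrefl _, ltrans h1 h2⟩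
    · exact ⟨s 2, s 3, ltrans h0 h1, h2, lrefl _⟩
    · exact ⟨s 1, s 2, h0, h1, h2⟩
    · exact ⟨s 1, s 3, h0, rtrans h1 h2, lrefl _⟩

theorem hasLSeq_dl {e f : E} (h : 1 ≤ dl e f) : HasLSeq e f (dl e f) :=
  Nat.sInf_mem (Nat.nonempty_of_pos_sInf h)

end Quotient

end Biorder

open Biorder in
theorem proposition5p6 {E : Type*} [Biorder.BiorderedSet E] (hreg : Biorder.IsRegular E)
    (z : E) (hE1 : Biorder.CondE1 z) (c : E → E) (hE2 : Biorder.CondE2 z c)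
    (e f : E) (hpos : 1 ≤ Biorder.dl e f) (hle : Biorder.dl e f ≤ 3) :
    ∃ (lat : Lattice (Biorder.LQuot E)) (_ : BoundedOrder (Biorder.LQuot E)),
      Biorder.IsLOrder lat ∧
      Biorder.InPerspective (Biorder.lClass e) (Biorder.lClass f) ∧
      (∃ g h : E, Biorder.RelL e g ∧ Biorder.RelR g h ∧ Biorder.RelL h f) ∧
      ∀ g h : E, Biorder.RelL e g → Biorder.RelR g h → Biorder.RelL h f →
        IsCompl (Biorder.lClass e) (Biorder.lClass (c g)) ∧
        IsCompl (Biorder.lClass f) (Biorder.lClass (c g)) := by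
  obtain ⟨lat, hlat⟩ := exists_lattice_isLOrder (exists_omL_meet hreg hE1 hE2)
    (exists_omL_join hreg hE1 hE2)
  let bdd : BoundedOrder (LQuot E) :=
    { top := lClass (c z)
      bot := lClass z
      le_top := LQuot.ind fun a => (hlat _ _).2 (omL_compl_zero hE1 hE2 a)
      bot_le := LQuot.ind fun a => (hlat _ _).2 (hE1 a).1 }
  have hcompl : ∀ a : E, IsCompl (lClass a) (lClass (c a)) := fun a => by
    refine isCompl_iff.2 ⟨fun x => ?_, fun x => ?_⟩
    · revert x
      refine LQuot.ind fun x hx hx' => (hlat _ _).2 ?_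
      rw [eq_zero_of_omL_compl hE1 hE2 ((hlat _ _).1 hx) ((hlat _ _).1 hx')]
      exact BiorderedSet.omL_refl z
    · revert x
      refine LQuot.ind fun x hx hx' => (hlat _ _).2 ?_
      rw [eq_compl_zero_of_omL hE1 hE2 ((hlat _ _).1 hx) ((hlat _ _).1 hx')]
      exact BiorderedSet.omL_refl _
  have hall : ∀ g h : E, RelL e g → RelR g h → RelL h f →
      IsCompl (lClass e) (lClass (c g)) ∧ IsCompl (lClass f) (lClass (c g)) := by
    intro g h hg hgh hf
    have hc : RelL (c g) (c h) := ⟨(hE2.omR_iff _ _).1 hgh.2, (hE2.omR_iff _ _).1 hgh.1⟩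
    refine ⟨lClass_eq_iff.2 hg ▸ hcompl g, ?_⟩
    rw [← lClass_eq_iff.2 hf, lClass_eq_iff.2 hc]
    exact hcompl h
  obtain ⟨g, h, hg, hgh, hf⟩ := (hasLSeq_dl hpos).exists_relL_relR_relL hle
  exact ⟨lat, bdd, hlat, ⟨lClass (c g), hall g h hg hgh hf⟩, ⟨g, h, hg, hgh, hf⟩, hall⟩
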